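/- Let $\mathcal H$ be a complex Hilbert space, let $L(\mathcal H)$ be the algebra of bounded linear operators on $\mathcal H$ with the operator norm, and let $T\in L(\mathcal H)$ be a product $T=AB$ of two bounded positive semidefinite operators $A,B\in L(\mathcal H)$. Then: (i) $T$ is a generalized scalar operator, that is, there is a continuous unital algebra homomorphism $\Phi\colon C^\infty(\mathbb C)\to L(\mathcal H)$ with $\Phi(z)=T$. Here $C^\infty(\mathbb C)$ is the algebra of complex-valued functions on $\mathbb C\cong\mathbb R^2$ that are infinitely differentiable in the real sense, with the topology of uniform convergence on compact sets of the functions and all their derivatives, and $z$ denotes the identity function of $\mathbb C$. (ii) $T$ has a $C^2([0,\|T\|])$ functional calculus, that is, there is a continuous unital algebra homomorphism $\Psi\colon C^2([0,\|T\|])\to L(\mathcal H)$ that maps the function $t\mapsto t$ to $T$. Here $C^2([0,\|T\|])$ is the algebra of twice continuously differentiable complex-valued functions on $[0,\|T\|]$ (one-sided derivatives at the end points; if $\|T\|=0$, all functions on $\{0\}$), with the topology of uniform convergence of the functions and their first two derivatives (if $\|T\|=0$, the usual topology of $\mathbb C$). -/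

import Mathlib

open scoped ContDiff UniformConvergence

noncomputable section

/-- The `ℂ`-algebra of all functions `ℂ → ℂ` that are infinitely differentiable in the real
sense (as functions of the two real variables `re z`, `im z`). -/
def smoothSubalgebra : Subalgebra ℂ (ℂ → ℂ) where
  carrier := {f | ContDiff ℝ ∞ f}
  mul_mem' {f g} hf hg :=
    ContDiff.mul (show ContDiff ℝ ∞ f from hf) (show ContDiff ℝ ∞ g from hg)
  add_mem' {f g} hf hg :=
    ContDiff.add (show ContDiff ℝ ∞ f from hf) (show ContDiff ℝ ∞ g from hg)
  algebraMap_mem' c := show ContDiff ℝ ∞ (fun _ : ℂ => c) from contDiff_const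

/-- The algebra `C^∞(ℂ)`. This is a copy of `smoothSubalgebra`, so that it does not inherit the
topology of pointwise convergence. -/
def SmoothPlane : Type := smoothSubalgebra

instance SmoothPlane.instCommRing : CommRing SmoothPlane :=
  inferInstanceAs (CommRing smoothSubalgebra)

instance SmoothPlane.instAlgebra : Algebra ℂ SmoothPlane :=
  inferInstanceAs (Algebra ℂ smoothSubalgebra)

/-- The underlying function of an element of `C^∞(ℂ)`. -/
def SmoothPlane.toFun (f : SmoothPlane) : ℂ → ℂ := f.1

/-- The standard Fréchet topology of `C^∞(ℂ)`: uniform convergence on compact sets of the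
functions together with all their (real) derivatives. -/
instance SmoothPlane.instTopologicalSpace : TopologicalSpace SmoothPlane :=
  ⨅ k : ℕ, TopologicalSpace.induced
    (fun f => UniformOnFun.ofFun {K : Set ℂ | IsCompact K} (iteratedFDeriv ℝ k f.toFun))
    inferInstance

/-- The coordinate function `z ↦ z` in `C^∞(ℂ)`. -/
def SmoothPlane.coord : SmoothPlane :=
  ⟨fun z => z, show ContDiff ℝ ∞ (fun z : ℂ => z) from contDiff_id⟩

/-- Extension by zero to `ℝ` of a function on `[a, b]`. It is only ever used within `[a, b]`. -/
def extendIcc {a b : ℝ} (f : Set.Icc a b → ℂ) : ℝ → ℂ :=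
  Function.extend Subtype.val f 0

theorem extendIcc_apply {a b : ℝ} (f : Set.Icc a b → ℂ) {x : ℝ} (hx : x ∈ Set.Icc a b) :
    extendIcc f x = f ⟨x, hx⟩ :=
  Subtype.val_injective.extend_apply f 0 ⟨x, hx⟩

/-- The `ℂ`-algebra of `n` times continuously differentiable functions `[a, b] → ℂ`, with
one-sided derivatives at the end points. -/
def ckSubalgebra (n : ℕ) (a b : ℝ) : Subalgebra ℂ (Set.Icc a b → ℂ) where
  carrier := {f | ContDiffOn ℝ n (extendIcc f) (Set.Icc a b)}
  mul_mem' {f g} hf hg := (ContDiffOn.mul hf hg).congr fun x hx => by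
    simp [extendIcc_apply _ hx]
  add_mem' {f g} hf hg := (ContDiffOn.add hf hg).congr fun x hx => by
    simp [extendIcc_apply _ hx]
  algebraMap_mem' c := (contDiffOn_const (c := c)).congr fun x hx => by
    simp [extendIcc_apply _ hx]

/-- The algebra `C^n([a, b])`. This is a copy of `ckSubalgebra n a b`, so that it does not inherit
the topology of pointwise convergence. -/
def CkIcc (n : ℕ) (a b : ℝ) : Type := ckSubalgebra n a b

instance CkIcc.instCommRing (n : ℕ) (a b : ℝ) : CommRing (CkIcc n a b) :=
  inferInstanceAs (CommRing (ckSubalgebra n a b))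

instance CkIcc.instAlgebra (n : ℕ) (a b : ℝ) : Algebra ℂ (CkIcc n a b) :=
  inferInstanceAs (Algebra ℂ (ckSubalgebra n a b))

/-- The underlying function of an element of `C^n([a, b])`. -/
def CkIcc.toFun {n : ℕ} {a b : ℝ} (f : CkIcc n a b) : Set.Icc a b → ℂ := f.1

/-- The `k`-th derivative on `[a, b]` (one-sided at the end points). -/
def CkIcc.deriv {n : ℕ} {a b : ℝ} (k : ℕ) (f : CkIcc n a b) : Set.Icc a b → ℂ :=
  fun x => iteratedDerivWithin k (extendIcc f.toFun) (Set.Icc a b) x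

/-- The standard (Banach space) topology of `C^n([a, b])`: uniform convergence on `[a, b]` of the
functions together with their derivatives of order at most `n`. -/
instance CkIcc.instTopologicalSpace (n : ℕ) (a b : ℝ) : TopologicalSpace (CkIcc n a b) :=
  ⨅ (k : ℕ) (_ : k ≤ n), TopologicalSpace.induced
    (fun f => UniformFun.ofFun (CkIcc.deriv k f)) inferInstance

/-- The coordinate function `t ↦ t` in `C^n([a, b])`. -/
def CkIcc.coord (n : ℕ) (a b : ℝ) : CkIcc n a b :=
  ⟨fun t => ((t : ℝ) : ℂ), (Complex.ofRealCLM.contDiff.contDiffOn (s := Set.Icc a b)).congr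
    fun x hx => by simp [extendIcc_apply _ hx]⟩

/-- The class of all products of two bounded positive (semidefinite) operators on `H`. -/
def posMulPos (H : Type*) [NormedAddCommGroup H] [InnerProductSpace ℂ H] : Set (H →L[ℂ] H) :=
  {T | ∃ A B : H →L[ℂ] H, A.IsPositive ∧ B.IsPositive ∧ T = A * B}

/-- `T` is a generalized scalar operator: there is a continuous unital algebra homomorphism
`Φ : C^∞(ℂ) → L(H)` with `Φ(z) = T`, where `L(H)` carries the operator norm topology. -/
def IsGeneralizedScalar {H : Type*} [NormedAddCommGroup H] [InnerProductSpace ℂ H]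
    (T : H →L[ℂ] H) : Prop :=
  ∃ Φ : SmoothPlane →ₐ[ℂ] (H →L[ℂ] H), Continuous Φ ∧ Φ SmoothPlane.coord = T

/-- `T` has a `C^n([a, b])` functional calculus: there is a continuous unital algebra homomorphism
`Φ : C^n([a, b]) → L(H)` that maps the function `t ↦ t` to `T`. -/
def HasCkFunctionalCalculus {H : Type*} [NormedAddCommGroup H] [InnerProductSpace ℂ H]
    (n : ℕ) (a b : ℝ) (T : H →L[ℂ] H) : Prop :=
  ∃ Φ : CkIcc n a b →ₐ[ℂ] (H →L[ℂ] H), Continuous Φ ∧ Φ (CkIcc.coord n a b) = T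

end

open Set Filter Topology

noncomputable section

/-! Write `T = A B = X Y` with `X = A^{1/2}` and `Y = A^{1/2} B`; then `Y X = A^{1/2} B A^{1/2}` is
positive, so it has a continuous functional calculus. For a polynomial `f` and `g(t) = (f t - f 0) /
t`, one has `f(X Y) = f 0 + X g(Y X) Y`. The right side makes sense as soon as `g` is continuous, so
it is taken as the definition of `f(T)` (`productCalculus`). It is multiplicative by a Leibniz-type
identity for `g` (`quotAtZero_mul`) and continuous because the mean value inequality gives `sup |g|
≤ sup |f'|` (`norm_quotAtZero_le`). Only one derivative is lost, so order 2 is more than enough.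
Since `X Y` and `Y X` have the same nonzero spectrum, `[0, ‖T‖]` contains the spectrum of `Y X`. The
smooth calculus on the plane follows by restriction to this interval. -/

/-! ### The difference quotient at `0` -/

/-- The difference quotient `(f t - f 0) / t`, with the one-sided derivative as value at `0`. -/
def quotAtZero (b : ℝ) (f : ℝ → ℂ) (t : ℝ) : ℂ :=
  if t = 0 then derivWithin f (Icc 0 b) 0 else (f t - f 0) / t

theorem quotAtZero_congr {b t : ℝ} (hb : 0 < b) {f g : ℝ → ℂ} (h : EqOn f g (Icc 0 b))
    (ht : t ∈ Icc 0 b) : quotAtZero b f t = quotAtZero b g t := by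
  have h0 : (0 : ℝ) ∈ Icc 0 b := ⟨le_rfl, hb.le⟩
  simp only [quotAtZero, h ht, h h0, derivWithin_congr h (h h0)]

theorem quotAtZero_const (b t : ℝ) (c : ℂ) : quotAtZero b (fun _ => c) t = 0 := by
  simp [quotAtZero]

theorem quotAtZero_ofReal {b : ℝ} (hb : 0 < b) (t : ℝ) :
    quotAtZero b (fun s => (s : ℂ)) t = 1 := by
  unfold quotAtZero
  split_ifs with h
  · exact (Complex.ofRealCLM.hasDerivWithinAt (s := Icc 0 b) (x := 0)).derivWithin
      (uniqueDiffOn_Icc hb 0 ⟨le_rfl, hb.le⟩)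
  · have : (t : ℂ) ≠ 0 := by exact_mod_cast h
    simp [this]

theorem quotAtZero_add {b : ℝ} {f g : ℝ → ℂ} (hf : DifferentiableWithinAt ℝ f (Icc 0 b) 0)
    (hg : DifferentiableWithinAt ℝ g (Icc 0 b) 0) (t : ℝ) :
    quotAtZero b (f + g) t = quotAtZero b f t + quotAtZero b g t := by
  unfold quotAtZero
  split_ifs with h
  · exact derivWithin_add hf hg
  · simp only [Pi.add_apply]
    ring

/-- Expand `f = f 0 + t p` and `g = g 0 + t q`. The factor `t` left in the last term later becomes
the `Y X` in the middle of `(X p Y)(X q Y)`. -/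
theorem quotAtZero_mul {b : ℝ} {f g : ℝ → ℂ} (hf : DifferentiableWithinAt ℝ f (Icc 0 b) 0)
    (hg : DifferentiableWithinAt ℝ g (Icc 0 b) 0) (t : ℝ) :
    quotAtZero b (f * g) t = f 0 * quotAtZero b g t + g 0 * quotAtZero b f t +
      quotAtZero b f t * (t * quotAtZero b g t) := by
  unfold quotAtZero
  split_ifs with h
  · rw [derivWithin_mul hf hg, h]
    simp only [Complex.ofReal_zero]
    ring
  · have : (t : ℂ) ≠ 0 := by exact_mod_cast h
    simp only [Pi.mul_apply]
    field_simp
    ring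

theorem continuousOn_quotAtZero {b : ℝ} {f : ℝ → ℂ} (hf : DifferentiableOn ℝ f (Icc 0 b)) :
    ContinuousOn (quotAtZero b f) (Icc 0 b) := by
  intro t ht
  by_cases h : t = 0
  · subst h
    have h1 := hasDerivWithinAt_iff_tendsto_slope.1 (hf 0 ht).hasDerivWithinAt
    -- Off `0` the quotient is the slope of `f`, so continuity at `0` is differentiability of `f`
    -- there.
    rw [← continuousWithinAt_sdiff_self]
    have h2 : quotAtZero b f 0 = derivWithin f (Icc 0 b) 0 := by simp [quotAtZero]
    rw [ContinuousWithinAt, h2]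
    refine h1.congr' ?_
    filter_upwards [self_mem_nhdsWithin] with s hs
    have hs0 : s ≠ 0 := hs.2
    simp only [quotAtZero, hs0, if_false, slope, vsub_eq_sub, sub_zero, Complex.real_smul,
      Complex.ofReal_inv]
    ring
  · have h1 : ContinuousWithinAt (fun s : ℝ => (f s - f 0) / (s : ℂ)) (Icc 0 b) t := by
      refine ContinuousWithinAt.div ((hf t ht).continuousWithinAt.sub continuousWithinAt_const)
        Complex.continuous_ofReal.continuousWithinAt (by exact_mod_cast h)
    refine h1.congr_of_eventuallyEq ?_ (by simp [quotAtZero, h])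
    filter_upwards [mem_nhdsWithin_of_mem_nhds (isOpen_ne.mem_nhds h)] with s hs
    simp only [quotAtZero, if_neg (show ¬ s = 0 from hs)]

theorem norm_quotAtZero_le {b C : ℝ} {f : ℝ → ℂ} (hf : DifferentiableOn ℝ f (Icc 0 b))
    (hC : ∀ t ∈ Icc 0 b, ‖derivWithin f (Icc 0 b) t‖ ≤ C) {t : ℝ} (ht : t ∈ Icc 0 b) :
    ‖quotAtZero b f t‖ ≤ C := by
  have h0 : (0 : ℝ) ∈ Icc 0 b := ⟨le_rfl, ht.1.trans ht.2⟩
  unfold quotAtZero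
  split_ifs with h
  · exact hC 0 h0
  · have := (convex_Icc 0 b).norm_image_sub_le_of_norm_derivWithin_le hf hC h0 ht
    rw [norm_div, Complex.norm_real, div_le_iff₀ (norm_pos_iff.2 h)]
    simpa using this

/-! ### The algebra `C^n([a, b])` -/

namespace CkIcc

variable {n : ℕ} {a b : ℝ}

theorem toFun_add (f g : CkIcc n a b) : (f + g).toFun = f.toFun + g.toFun := rfl

theorem toFun_mul (f g : CkIcc n a b) : (f * g).toFun = f.toFun * g.toFun := rfl

theorem toFun_algebraMap (c : ℂ) : (algebraMap ℂ (CkIcc n a b) c).toFun = fun _ => c := rfl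

theorem toFun_coord : (coord n a b).toFun = fun t : Icc a b => ((t : ℝ) : ℂ) := rfl

theorem extend_add (f g : CkIcc n a b) :
    EqOn (extendIcc (f + g).toFun) (extendIcc f.toFun + extendIcc g.toFun) (Icc a b) :=
  fun x hx => by simp [extendIcc_apply _ hx, toFun_add]

theorem extend_mul (f g : CkIcc n a b) :
    EqOn (extendIcc (f * g).toFun) (extendIcc f.toFun * extendIcc g.toFun) (Icc a b) :=
  fun x hx => by simp [extendIcc_apply _ hx, toFun_mul]

theorem extend_algebraMap (c : ℂ) :
    EqOn (extendIcc (algebraMap ℂ (CkIcc n a b) c).toFun) (fun _ => c) (Icc a b) :=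
  fun x hx => by simp [extendIcc_apply _ hx, toFun_algebraMap]

theorem extend_coord : EqOn (extendIcc (coord n a b).toFun) (fun t => (t : ℂ)) (Icc a b) :=
  fun x hx => by simp [extendIcc_apply _ hx, toFun_coord]

theorem differentiableOn (hn : 1 ≤ n) (f : CkIcc n a b) :
    DifferentiableOn ℝ (extendIcc f.toFun) (Icc a b) :=
  ContDiffOn.differentiableOn (n := n) f.2 (by exact_mod_cast (by omega : n ≠ 0))

theorem deriv_zero (f : CkIcc n a b) (x : Icc a b) : f.deriv 0 x = f.toFun x := by
  simp only [deriv, iteratedDerivWithin_zero]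
  exact extendIcc_apply _ x.2

theorem deriv_add {k : ℕ} (hk : k ≤ n) (hab : a < b) (f g : CkIcc n a b) (x : Icc a b) :
    (f + g).deriv k x = f.deriv k x + g.deriv k x := by
  have hle : (k : WithTop ℕ∞) ≤ n := by exact_mod_cast hk
  have hf : ContDiffOn ℝ n (extendIcc f.toFun) (Icc a b) := f.2
  have hg : ContDiffOn ℝ n (extendIcc g.toFun) (Icc a b) := g.2
  simp only [deriv]
  rw [iteratedDerivWithin_congr (extend_add f g) x.2]
  exact iteratedDerivWithin_add x.2 (uniqueDiffOn_Icc hab) ((hf x x.2).of_le hle)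
    ((hg x x.2).of_le hle)

theorem deriv_sub {k : ℕ} (hk : k ≤ n) (hab : a < b) (f g : CkIcc n a b) (x : Icc a b) :
    (f - g).deriv k x = f.deriv k x - g.deriv k x := by
  have := deriv_add hk hab (f - g) g x
  rw [sub_add_cancel] at this
  rw [this, add_sub_cancel_right]

theorem continuous_deriv {k : ℕ} (hk : k ≤ n) :
    Continuous fun f : CkIcc n a b => UniformFun.ofFun (f.deriv k) :=
  continuous_iInf_dom (i := k) (continuous_iInf_dom (i := hk) continuous_induced_dom)

theorem continuous_iff {Z : Type*} [TopologicalSpace Z] {F : Z → CkIcc n a b} :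
    Continuous F ↔ ∀ k ≤ n, Continuous fun z => UniformFun.ofFun ((F z).deriv k) := by
  simp only [continuous_iInf_rng, continuous_induced_rng]
  rfl

theorem eventually_norm_deriv_sub_lt {k : ℕ} (hk : k ≤ n) (f : CkIcc n a b) {ε : ℝ}
    (hε : 0 < ε) : ∀ᶠ g in 𝓝 f, ∀ x, ‖g.deriv k x - f.deriv k x‖ < ε := by
  have h := UniformFun.tendsto_iff_tendstoUniformly.1 ((continuous_deriv hk).tendsto f)
  filter_upwards [Metric.tendstoUniformly_iff.1 h ε hε] with g hg x
  rw [← dist_eq_norm, dist_comm]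
  exact hg x

theorem continuous_eval (x : Icc a b) : Continuous fun f : CkIcc n a b => f.toFun x := by
  have := (UniformFun.uniformContinuous_eval ℂ x).continuous.comp
    (continuous_deriv (n := n) (a := a) (b := b) (Nat.zero_le n))
  refine this.congr fun f => ?_
  exact deriv_zero f x

/-- Evaluation at a point, as an algebra homomorphism. -/
def evalHom (n : ℕ) (x : Icc a b) : CkIcc n a b →ₐ[ℂ] ℂ where
  toFun f := f.toFun x
  map_one' := rfl
  map_mul' _ _ := rfl
  map_zero' := rfl
  map_add' _ _ := rfl
  commutes' _ := rfl

end CkIcc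

/-! ### The algebra `C^∞(ℂ)` -/

namespace SmoothPlane

theorem continuous_iteratedFDeriv (k : ℕ) : Continuous fun F : SmoothPlane =>
    UniformOnFun.ofFun {K : Set ℂ | IsCompact K} (iteratedFDeriv ℝ k F.toFun) :=
  continuous_iInf_dom (i := k) continuous_induced_dom

theorem eventually_norm_iteratedFDeriv_sub_lt (k : ℕ) {K : Set ℂ} (hK : IsCompact K)
    (F : SmoothPlane) {ε : ℝ} (hε : 0 < ε) : ∀ᶠ G in 𝓝 F, ∀ z ∈ K,
      ‖iteratedFDeriv ℝ k G.toFun z - iteratedFDeriv ℝ k F.toFun z‖ < ε := by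
  have h := UniformOnFun.tendsto_iff_tendstoUniformlyOn.1
    ((continuous_iteratedFDeriv k).tendsto F) K hK
  filter_upwards [Metric.tendstoUniformlyOn_iff.1 h ε hε] with G hG z hz
  rw [← dist_eq_norm, dist_comm]
  exact hG z hz

/-- Restriction of smooth functions to a compact interval. -/
def restrictIcc (n : ℕ) (a b : ℝ) : SmoothPlane →ₐ[ℂ] CkIcc n a b where
  toFun F := ⟨fun t => F.toFun (t : ℝ), by
    have hF : ContDiff ℝ ∞ F.toFun := F.2
    have h : ContDiff ℝ n (fun t : ℝ => F.toFun t) :=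
      (hF.of_le (by exact_mod_cast le_top)).comp Complex.ofRealCLM.contDiff
    exact h.contDiffOn.congr fun x hx => extendIcc_apply _ hx⟩
  map_one' := rfl
  map_mul' _ _ := rfl
  map_zero' := rfl
  map_add' _ _ := rfl
  commutes' _ := rfl

/-- Chain rule along the linear inclusion of `ℝ` in `ℂ`, which sends the unit tangent vector to `1`.
This bounds one-sided derivatives on the interval by real derivatives on the plane. -/
theorem deriv_restrictIcc {n : ℕ} {a b : ℝ} (hab : a < b) (k : ℕ) (F : SmoothPlane)
    (x : Icc a b) : (restrictIcc n a b F).deriv k x =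
      iteratedFDeriv ℝ k F.toFun (x : ℝ) fun _ => 1 := by
  have hF : ContDiff ℝ ∞ F.toFun := F.2
  have hk : (k : WithTop ℕ∞) ≤ ∞ := by exact_mod_cast le_top
  have h1 : EqOn (extendIcc (restrictIcc n a b F).toFun) (F.toFun ∘ Complex.ofRealCLM)
      (Icc a b) := fun y hy => extendIcc_apply _ hy
  have h2 : ContDiff ℝ ∞ (F.toFun ∘ Complex.ofRealCLM) := hF.comp Complex.ofRealCLM.contDiff
  rw [CkIcc.deriv, iteratedDerivWithin_congr h1 x.2, iteratedDerivWithin_eq_iteratedDeriv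
    (uniqueDiffOn_Icc hab) (h2.of_le hk).contDiffAt x.2, iteratedDeriv_eq_iteratedFDeriv,
    Complex.ofRealCLM.iteratedFDeriv_comp_right hF _ hk]
  simp [ContinuousMultilinearMap.compContinuousLinearMap_apply]

theorem continuous_restrictIcc (n : ℕ) {a b : ℝ} (hab : a < b) :
    Continuous (restrictIcc n a b) := by
  refine CkIcc.continuous_iff.2 fun k _ => continuous_iff_continuousAt.2 fun F => ?_
  refine UniformFun.tendsto_iff_tendstoUniformly.2 (Metric.tendstoUniformly_iff.2 fun ε hε => ?_)
  have hK : IsCompact ((fun t : ℝ => (t : ℂ)) '' Icc a b) :=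
    isCompact_Icc.image Complex.continuous_ofReal
  filter_upwards [eventually_norm_iteratedFDeriv_sub_lt k hK F hε] with G hG x
  rw [dist_comm, dist_eq_norm]
  change ‖(restrictIcc n a b G).deriv k x - (restrictIcc n a b F).deriv k x‖ < ε
  rw [deriv_restrictIcc hab, deriv_restrictIcc hab, ← sub_apply]
  refine (ContinuousMultilinearMap.le_opNorm _ _).trans_lt ?_
  simpa using hG x ⟨x, x.2, rfl⟩

theorem continuous_eval (z : ℂ) : Continuous fun F : SmoothPlane => F.toFun z := by
  refine continuous_iff_continuousAt.2 fun F => Metric.tendsto_nhds.2 fun ε hε => ?_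
  filter_upwards [eventually_norm_iteratedFDeriv_sub_lt 0 (isCompact_singleton (x := z)) F hε]
    with G hG
  -- The final `0` is the empty tuple of vectors, at which the derivative of order zero is the value
  -- of the function.
  have h := (ContinuousMultilinearMap.le_opNorm (iteratedFDeriv ℝ 0 G.toFun z -
    iteratedFDeriv ℝ 0 F.toFun z) 0).trans_lt (by simpa using hG z rfl)
  simpa [dist_eq_norm] using h

/-- Evaluation at a point, as an algebra homomorphism. -/
def evalHom (z : ℂ) : SmoothPlane →ₐ[ℂ] ℂ where
  toFun F := F.toFun z
  map_one' := rfl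
  map_mul' _ _ := rfl
  map_zero' := rfl
  map_add' _ _ := rfl
  commutes' _ := rfl

end SmoothPlane

/-! ### The functional calculus of a product -/

section Product

variable {A : Type*} [CStarAlgebra A]

/-- The map `f ↦ f 0 + X g(Y X) Y`, where `g(t) = (f t - f 0) / t`. It is a functional calculus for
`X Y` built from the continuous functional calculus of `Y X`. -/
def productCalculus (b : ℝ) (X Y : A) (f : ℝ → ℂ) : A :=
  algebraMap ℂ A (f 0) + X * cfc (fun z : ℂ => quotAtZero b f z.re) (Y * X) * Y

variable {b : ℝ} {X Y : A}

theorem continuousOn_quotAtZero_re (hS : spectrum ℂ (Y * X) ⊆ Complex.ofReal '' Icc 0 b)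
    {f : ℝ → ℂ} (hf : DifferentiableOn ℝ f (Icc 0 b)) :
    ContinuousOn (fun z : ℂ => quotAtZero b f z.re) (spectrum ℂ (Y * X)) := by
  refine (continuousOn_quotAtZero hf).comp Complex.continuous_re.continuousOn fun z hz => ?_
  obtain ⟨t, ht, rfl⟩ := hS hz
  exact ht

theorem productCalculus_congr (hb : 0 < b)
    (hS : spectrum ℂ (Y * X) ⊆ Complex.ofReal '' Icc 0 b) {f g : ℝ → ℂ}
    (h : EqOn f g (Icc 0 b)) : productCalculus b X Y f = productCalculus b X Y g := by
  have : (spectrum ℂ (Y * X)).EqOn (fun z : ℂ => quotAtZero b f z.re)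
      (fun z : ℂ => quotAtZero b g z.re) := fun z hz => by
    obtain ⟨t, ht, rfl⟩ := hS hz
    exact quotAtZero_congr hb h ht
  rw [productCalculus, productCalculus, cfc_congr this, h ⟨le_rfl, hb.le⟩]

theorem productCalculus_const (c : ℂ) :
    productCalculus b X Y (fun _ => c) = algebraMap ℂ A c := by
  simp [productCalculus, quotAtZero_const]

theorem productCalculus_ofReal (hb : 0 < b) (hYX : IsStarNormal (Y * X)) :
    productCalculus b X Y (fun t => (t : ℂ)) = X * Y := by
  simp [productCalculus, quotAtZero_ofReal hb, cfc_const_one ℂ (Y * X)]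

theorem productCalculus_add (hb : 0 < b)
    (hS : spectrum ℂ (Y * X) ⊆ Complex.ofReal '' Icc 0 b) {f g : ℝ → ℂ}
    (hf : DifferentiableOn ℝ f (Icc 0 b)) (hg : DifferentiableOn ℝ g (Icc 0 b)) :
    productCalculus b X Y (f + g) = productCalculus b X Y f + productCalculus b X Y g := by
  have h0 : (0 : ℝ) ∈ Icc 0 b := ⟨le_rfl, hb.le⟩
  simp only [productCalculus, quotAtZero_add (hf 0 h0) (hg 0 h0), Pi.add_apply, map_add]
  rw [cfc_add _ _ _ (continuousOn_quotAtZero_re hS hf) (continuousOn_quotAtZero_re hS hg)]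
  noncomm_ring

theorem productCalculus_mul (hb : 0 < b) (hYX : IsStarNormal (Y * X))
    (hS : spectrum ℂ (Y * X) ⊆ Complex.ofReal '' Icc 0 b) {f g : ℝ → ℂ}
    (hf : DifferentiableOn ℝ f (Icc 0 b)) (hg : DifferentiableOn ℝ g (Icc 0 b)) :
    productCalculus b X Y (f * g) = productCalculus b X Y f * productCalculus b X Y g := by
  have h0 : (0 : ℝ) ∈ Icc 0 b := ⟨le_rfl, hb.le⟩
  have hf' := continuousOn_quotAtZero_re hS hf
  have hg' := continuousOn_quotAtZero_re hS hg
  have hcfc : cfc (fun z : ℂ => quotAtZero b (f * g) z.re) (Y * X) =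
      f 0 • cfc (fun z : ℂ => quotAtZero b g z.re) (Y * X) +
      g 0 • cfc (fun z : ℂ => quotAtZero b f z.re) (Y * X) +
      cfc (fun z : ℂ => quotAtZero b f z.re) (Y * X) * (Y * X *
        cfc (fun z : ℂ => quotAtZero b g z.re) (Y * X)) := by
    rw [← cfc_const_mul _ _ _ hg', ← cfc_const_mul _ _ _ hf', ← cfc_add _ _ _ (by fun_prop)
      (by fun_prop)]
    -- Only the middle factor `Y X` is turned into the calculus of the identity, so that the product
    -- merges into a single `cfc`.
    conv_rhs =>
      enter [2, 2, 1]
      rw [← cfc_id' ℂ (Y * X)]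
    rw [← cfc_mul _ _ _ (by fun_prop) hg', ← cfc_mul _ _ _ hf' (by fun_prop),
      ← cfc_add _ _ _ (by fun_prop) (by fun_prop)]
    refine cfc_congr fun z hz => ?_
    obtain ⟨t, ht, rfl⟩ := hS hz
    exact quotAtZero_mul (hf 0 h0) (hg 0 h0) t
  simp only [productCalculus, hcfc, Pi.mul_apply, map_mul, Algebra.algebraMap_eq_smul_one]
  simp only [mul_add, add_mul, smul_mul_assoc, mul_smul_comm, one_mul, mul_one, mul_assoc,
    smul_smul, smul_add]
  abel

theorem norm_productCalculus_le (hS : spectrum ℂ (Y * X) ⊆ Complex.ofReal '' Icc 0 b)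
    {f : ℝ → ℂ} (hf : DifferentiableOn ℝ f (Icc 0 b)) {C : ℝ} (hC0 : 0 ≤ C)
    (hC : ∀ t ∈ Icc 0 b, ‖derivWithin f (Icc 0 b) t‖ ≤ C) :
    ‖productCalculus b X Y f‖ ≤ ‖f 0‖ * ‖(1 : A)‖ + ‖X‖ * C * ‖Y‖ := by
  refine (norm_add_le _ _).trans (add_le_add (norm_algebraMap _ _).le ?_)
  refine (norm_mul_le _ _).trans (mul_le_mul_of_nonneg_right ?_ (norm_nonneg _))
  refine (norm_mul_le _ _).trans (mul_le_mul_of_nonneg_left ?_ (norm_nonneg _))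
  refine norm_cfc_le hC0 fun z hz => ?_
  obtain ⟨t, ht, rfl⟩ := hS hz
  exact norm_quotAtZero_le hf hC ht

/-- If `Y X` is normal with spectrum in `[0, b]`, then `X Y` has a `C^n([0, b])` functional
calculus for every `n ≥ 1`. -/
def productCalculusHom {n : ℕ} (hn : 1 ≤ n) (hb : 0 < b) (hYX : IsStarNormal (Y * X))
    (hS : spectrum ℂ (Y * X) ⊆ Complex.ofReal '' Icc 0 b) : CkIcc n 0 b →ₐ[ℂ] A :=
  have hc (c : ℂ) : productCalculus b X Y (extendIcc (algebraMap ℂ (CkIcc n 0 b) c).toFun) =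
      algebraMap ℂ A c := by
    rw [productCalculus_congr hb hS (CkIcc.extend_algebraMap c), productCalculus_const]
  { toFun f := productCalculus b X Y (extendIcc f.toFun)
    map_one' := by simpa using hc 1
    map_zero' := by simpa using hc 0
    map_add' f g := by
      rw [productCalculus_congr hb hS (CkIcc.extend_add f g)]
      exact productCalculus_add hb hS (f.differentiableOn hn) (g.differentiableOn hn)
    map_mul' f g := by
      rw [productCalculus_congr hb hS (CkIcc.extend_mul f g)]
      exact productCalculus_mul hb hYX hS (f.differentiableOn hn) (g.differentiableOn hn)
    commutes' := hc }

theorem productCalculusHom_coord {n : ℕ} (hn : 1 ≤ n) (hb : 0 < b) (hYX : IsStarNormal (Y * X))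
    (hS : spectrum ℂ (Y * X) ⊆ Complex.ofReal '' Icc 0 b) :
    productCalculusHom hn hb hYX hS (CkIcc.coord n 0 b) = X * Y :=
  (productCalculus_congr hb hS CkIcc.extend_coord).trans (productCalculus_ofReal hb hYX)

theorem continuous_productCalculusHom {n : ℕ} (hn : 1 ≤ n) (hb : 0 < b)
    (hYX : IsStarNormal (Y * X)) (hS : spectrum ℂ (Y * X) ⊆ Complex.ofReal '' Icc 0 b) :
    Continuous (productCalculusHom hn hb hYX hS) := by
  refine continuous_iff_continuousAt.2 fun f => Metric.tendsto_nhds.2 fun ε hε => ?_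
  have h0 : (0 : ℝ) ∈ Icc 0 b := ⟨le_rfl, hb.le⟩
  set M := ‖(1 : A)‖ + ‖X‖ * ‖Y‖ with hM
  have hM0 : 0 ≤ M := by positivity
  -- `M` bounds the homomorphism in the `C^1` norm; the `+ 1` covers `M = 0` and makes the final
  -- estimate strict.
  have hδ : 0 < ε / (M + 1) := by positivity
  filter_upwards [CkIcc.eventually_norm_deriv_sub_lt (Nat.zero_le n) f hδ,
    CkIcc.eventually_norm_deriv_sub_lt hn f hδ] with g hg0 hg1
  rw [dist_eq_norm, ← map_sub]
  have hC : ∀ t ∈ Icc 0 b, ‖derivWithin (extendIcc (g - f).toFun) (Icc 0 b) t‖ ≤ ε / (M + 1) := by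
    intro t ht
    have := (hg1 ⟨t, ht⟩).le
    rw [← CkIcc.deriv_sub hn hb] at this
    simpa only [CkIcc.deriv, iteratedDerivWithin_one] using this
  have hv : ‖extendIcc (g - f).toFun 0‖ ≤ ε / (M + 1) := by
    have := (hg0 ⟨0, h0⟩).le
    rw [← CkIcc.deriv_sub (Nat.zero_le n) hb] at this
    simpa only [CkIcc.deriv, iteratedDerivWithin_zero] using this
  calc ‖productCalculusHom hn hb hYX hS (g - f)‖
      ≤ ‖extendIcc (g - f).toFun 0‖ * ‖(1 : A)‖ + ‖X‖ * (ε / (M + 1)) * ‖Y‖ :=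
        norm_productCalculus_le hS ((g - f).differentiableOn hn) hδ.le hC
    _ ≤ ε / (M + 1) * ‖(1 : A)‖ + ‖X‖ * (ε / (M + 1)) * ‖Y‖ := by gcongr
    _ = ε / (M + 1) * M := by rw [hM]; ring
    _ < ε / (M + 1) * (M + 1) := by gcongr; linarith
    _ = ε := by field_simp

end Product

/-! ### Products of two positive operators -/

section Operators

variable {H : Type*} [NormedAddCommGroup H] [InnerProductSpace ℂ H]

/-- Evaluation at `0` suffices, and involves no derivatives; hence the degenerate interval `[0, 0]`
is allowed. -/
theorem hasCkFunctionalCalculus_zero (n : ℕ) {a b : ℝ} (h : (0 : ℝ) ∈ Icc a b) :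
    HasCkFunctionalCalculus n a b (0 : H →L[ℂ] H) := by
  refine ⟨(Algebra.ofId ℂ (H →L[ℂ] H)).comp (CkIcc.evalHom n ⟨0, h⟩), ?_, ?_⟩
  · exact (continuous_algebraMap ℂ (H →L[ℂ] H)).comp (CkIcc.continuous_eval _)
  · change algebraMap ℂ (H →L[ℂ] H) ((0 : ℝ) : ℂ) = 0
    simp

theorem isGeneralizedScalar_zero : IsGeneralizedScalar (0 : H →L[ℂ] H) := by
  refine ⟨(Algebra.ofId ℂ (H →L[ℂ] H)).comp (SmoothPlane.evalHom 0), ?_, ?_⟩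
  · exact (continuous_algebraMap ℂ (H →L[ℂ] H)).comp (SmoothPlane.continuous_eval _)
  · exact map_zero (algebraMap ℂ (H →L[ℂ] H))

theorem HasCkFunctionalCalculus.isGeneralizedScalar {n : ℕ} {a b : ℝ} (hab : a < b)
    {T : H →L[ℂ] H} (h : HasCkFunctionalCalculus n a b T) : IsGeneralizedScalar T := by
  obtain ⟨Φ, hΦ, hT⟩ := h
  exact ⟨Φ.comp (SmoothPlane.restrictIcc n a b),
    hΦ.comp (SmoothPlane.continuous_restrictIcc n hab), hT⟩

variable [CompleteSpace H]

theorem exists_factorization_of_mem_posMulPos {T : H →L[ℂ] H} (hT : T ∈ posMulPos H) :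
    ∃ X Y : H →L[ℂ] H, T = X * Y ∧ 0 ≤ Y * X := by
  obtain ⟨A, B, hA, hB, rfl⟩ := hT
  rw [← ContinuousLinearMap.nonneg_iff_isPositive] at hA hB
  refine ⟨CFC.sqrt A, CFC.sqrt A * B, ?_, ?_⟩
  · rw [← mul_assoc, CFC.sqrt_mul_sqrt_self A hA]
  · exact conjugate_nonneg_of_nonneg hB (CFC.sqrt_nonneg A)

/-- Positivity makes the spectrum real and nonnegative. The bound is by `‖X * Y‖`, not `‖Y * X‖`,
since nonzero spectral values of the two products agree. -/
theorem spectrum_subset_of_nonneg_of_mul_comm {X Y : H →L[ℂ] H} (h : 0 ≤ Y * X) :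
    spectrum ℂ (Y * X) ⊆ Complex.ofReal '' Icc 0 ‖X * Y‖ := by
  intro z hz
  rcases subsingleton_or_nontrivial (H →L[ℂ] H) with _ | _
  · simp [spectrum.of_subsingleton] at hz
  have hsa : IsSelfAdjoint (Y * X) := IsSelfAdjoint.of_nonneg h
  have hre := hsa.mem_spectrum_eq_re hz
  have hmem : z.re ∈ spectrum ℝ (Y * X) := by
    rw [← spectrum.algebraMap_mem_iff ℂ, Complex.coe_algebraMap, ← hre]
    exact hz
  have h0 : 0 ≤ z.re := spectrum_nonneg_of_nonneg h hmem
  refine ⟨z.re, ⟨h0, ?_⟩, hre.symm⟩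
  by_cases hz0 : z = 0
  · simp [hz0]
  · have hz' : z ∈ spectrum ℂ (X * Y) \ {0} := by
      rw [spectrum.nonzero_mul_comm]
      exact ⟨hz, hz0⟩
    exact (Complex.re_le_norm z).trans (spectrum.norm_le_norm_of_mem hz'.1)

end Operators

end

theorem mainTheorem1 {H : Type*} [NormedAddCommGroup H] [InnerProductSpace ℂ H] [CompleteSpace H]
    (T : H →L[ℂ] H) (hT : T ∈ posMulPos H) :
    IsGeneralizedScalar T ∧ HasCkFunctionalCalculus 2 0 ‖T‖ T := by
  -- For `T = 0` the interval is a point, where derivatives within it are not unique.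
  rcases eq_or_ne T 0 with rfl | h0
  · exact ⟨isGeneralizedScalar_zero, hasCkFunctionalCalculus_zero 2 (by simp)⟩
  have hb : 0 < ‖T‖ := norm_pos_iff.2 h0
  obtain ⟨X, Y, rfl, hYX⟩ := exists_factorization_of_mem_posMulPos hT
  have hS := spectrum_subset_of_nonneg_of_mul_comm hYX
  have hN : IsStarNormal (Y * X) := (IsSelfAdjoint.of_nonneg hYX).isStarNormal
  have h2 : HasCkFunctionalCalculus 2 0 ‖X * Y‖ (X * Y) :=
    ⟨productCalculusHom one_le_two hb hN hS, continuous_productCalculusHom one_le_two hb hN hS,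
      productCalculusHom_coord one_le_two hb hN hS⟩
  exact ⟨h2.isGeneralizedScalar hb, h2⟩
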